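/- Let $n,p$ be nonnegative integers, let $X\in\mathbb{R}^{n\times p}$ have rows $x_1^\top,\dots,x_n^\top$, let $y\in\mathbb{R}^n$, and let $\gamma>0$, $\lambda>0$, $\alpha\in(0,1)$. Write $Z=(s,\beta_0,\beta)\in\mathbb{R}^p\times\mathbb{R}\times\mathbb{R}^p=\mathbb{R}^{2p+1}$, $r_i(Z)=y_i-\beta_0-x_i^\top\beta$, and let $h_\gamma'(t)=t/\gamma$ if $|t|\le\gamma$ and $h_\gamma'(t)=\operatorname{sgn}(t)$ if $|t|>\gamma$ (the derivative of the Huber loss), $\psi_\gamma(t)=\frac1\gamma I(|t|\le\gamma)$, and $S(t)=\operatorname{sgn}(t)(|t|-1)_+$. Let $F:\mathbb{R}^{2p+1}\to\mathbb{R}^{2p+1}$ be the map of the KKT system of elastic-net penalized Huber regression, $$F(Z)=\begin{pmatrix}\bigl(\beta_j-S(\beta_j+s_j)\bigr)_{j=1}^p\\[2pt] -\frac1n\sum_{i} h_\gamma'(r_i(Z))\\[2pt] \bigl(-\frac1n\sum_{i} h_\gamma'(r_i(Z))\,x_{ij}+\lambda\alpha s_j+\lambda(1-\alpha)\beta_j\bigr)_{j=1}^p\end{pmatrix}.$$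 Let $A=A(Z)=\{j:|\beta_j+s_j|>1\}$, let $B=B(Z)$ be its complement in $\{1,\dots,p\}$, let $D_A,D_B\in\mathbb{R}^{p\times p}$ be the diagonal $0/1$ matrices that indicate $A$ and $B$, let $\Psi=\Psi(Z)=\frac1n\operatorname{diag}\bigl(\psi_\gamma(r_1(Z)),\dots,\psi_\gamma(r_n(Z))\bigr)$, let $\mathbf 1\in\mathbb{R}^n$ be the vector of ones, and put (columns ordered as $(s,\beta_0,\beta)$) $$H(Z)=\begin{pmatrix}-D_A&0&D_B\\ 0&\mathbf 1^\top\Psi\mathbf 1&\mathbf 1^\top\Psi X\\ \lambda\alpha I_p&X^\top\Psi\mathbf 1&X^\top\Psi X+\lambda(1-\alpha)I_p\end{pmatrix}.$$ Suppose that $F(\widehat Z)=0$ and that $\widehat Z$ has a neighborhood $\mathcal N$ such that for every $Z\in\mathcal N$ there is an $i\in\{1,\dots,n\}$ with $|r_i(Z)|\le\gamma$. Then there is a $\delta>0$ such that for every $Z^0$ with $\|Z^0-\widehat Z\|_2<\delta$ the iteration $$Z^{k+1}=Z^k-H(Z^k)^{-1}F(Z^k),\qquad k=0,1,2,\dots,$$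 is well defined (every $H(Z^k)$ is invertible) and converges superlinearly to $\widehat Z$, that is, $Z^k\to\widehat Z$ and $\|Z^{k+1}-\widehat Z\|_2=o(\|Z^k-\widehat Z\|_2)$ as $k\to\infty$. -/

import Mathlib

open Filter Topology

noncomputable section

namespace HuberSNA

/-- The derivative `h'_γ` of the Huber loss `h_γ` (`h_γ(t) = t² / (2γ)` for `|t| ≤ γ` and
`h_γ(t) = |t| - γ/2` for `|t| > γ`). -/
def huberDeriv (γ t : ℝ) : ℝ := if |t| ≤ γ then t / γ else Real.sign t

/-- `ψ_γ(t) = (1/γ) I(|t| ≤ γ)`. -/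
def psi (γ t : ℝ) : ℝ := if |t| ≤ γ then 1 / γ else 0

/-- Soft thresholding with threshold `1`: `S(z) = sgn(z) (|z| - 1)₊`. -/
def softThreshold (z : ℝ) : ℝ := Real.sign z * max (|z| - 1) 0

/-- Index set of the `2p + 1` coordinates of `Z = (s, β₀, β)`, and of the `2p + 1` equations:
the `p` equations `β_j - S(β_j + s_j) = 0`, the intercept equation, the `p` stationarity
equations. -/
abbrev Idx (p : ℕ) : Type := Fin p ⊕ Unit ⊕ Fin p

/-- `ℝ^{2p+1}` with the Euclidean norm. -/
abbrev Vec (p : ℕ) : Type := EuclideanSpace ℝ (Idx p)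

variable {n p : ℕ}

/-- The component `s` of `Z = (s, β₀, β)`. -/
def sPart (Z : Vec p) : Fin p → ℝ := fun j => Z (Sum.inl j)

/-- The component `β₀` of `Z = (s, β₀, β)`. -/
def interceptPart (Z : Vec p) : ℝ := Z (Sum.inr (Sum.inl ()))

/-- The component `β` of `Z = (s, β₀, β)`. -/
def betaPart (Z : Vec p) : Fin p → ℝ := fun j => Z (Sum.inr (Sum.inr j))

/-- The residual `y_i - β₀ - x_iᵀ β`, where `x_i` is the `i`-th row of `X`. -/
def residual (X : Matrix (Fin n) (Fin p) ℝ) (y : Fin n → ℝ) (Z : Vec p) (i : Fin n) : ℝ :=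
  y i - interceptPart Z - ∑ j, X i j * betaPart Z j

/-- The left-hand side `F(Z)` of the KKT system of elastic-net penalized Huber regression. -/
def kktMap (X : Matrix (Fin n) (Fin p) ℝ) (y : Fin n → ℝ) (γ lam α : ℝ) (Z : Vec p) : Vec p :=
  WithLp.toLp 2 fun
    | Sum.inl j => betaPart Z j - softThreshold (betaPart Z j + sPart Z j)
    | Sum.inr (Sum.inl _) => -(1 / (n : ℝ)) * ∑ i, huberDeriv γ (residual X y Z i)
    | Sum.inr (Sum.inr j) =>
        -(1 / (n : ℝ)) * ∑ i, X i j * huberDeriv γ (residual X y Z i)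
          + lam * α * sPart Z j + lam * (1 - α) * betaPart Z j

/-- The active set `A = {j : |β_j + s_j| > 1}`; its complement is `B`. -/
def activeSet (Z : Vec p) : Finset (Fin p) :=
  Finset.univ.filter fun j => 1 < |betaPart Z j + sPart Z j|

/-- `Ψ = (1/n) diag(ψ_γ(y_1 - β₀ - x_1ᵀβ), …, ψ_γ(y_n - β₀ - x_nᵀβ))`. -/
def psiMatrix (X : Matrix (Fin n) (Fin p) ℝ) (y : Fin n → ℝ) (γ : ℝ) (Z : Vec p) :
    Matrix (Fin n) (Fin n) ℝ :=
  (1 / (n : ℝ)) • Matrix.diagonal fun i => psi γ (residual X y Z i)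

/-- The column `1_n` of ones. -/
def onesCol (n : ℕ) : Matrix (Fin n) Unit ℝ := Matrix.of fun _ _ => 1

/-- The Newton derivative `H(Z)` of the KKT map, with rows indexed by the equations and columns
by the coordinates `(s, β₀, β)`. Listing the columns in the order `(s_A, β_B, β₀, β_A, s_B)` and
the rows with the indices in `A` before those in `B` (a reordering that depends on `Z`) turns it
into the block matrix
`[-I 0 0 0 0; 0 I 0 0 0; 0 1ᵀΨX_B 1ᵀΨ1 1ᵀΨX_A 0;
  λαI X_AᵀΨX_B X_AᵀΨ1 X_AᵀΨX_A+λ(1-α)I 0; 0 X_BᵀΨX_B+λ(1-α)I X_BᵀΨ1 X_BᵀΨX_A λαI]`. -/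
def newtonDeriv (X : Matrix (Fin n) (Fin p) ℝ) (y : Fin n → ℝ) (γ lam α : ℝ) (Z : Vec p) :
    Matrix (Idx p) (Idx p) ℝ :=
  let Ψ := psiMatrix X y γ Z
  let e := onesCol n
  Matrix.fromBlocks
    (Matrix.diagonal fun j => if j ∈ activeSet Z then -1 else 0)
    (Matrix.fromCols 0 (Matrix.diagonal fun j => if j ∈ activeSet Z then 0 else 1))
    (Matrix.fromRows 0 ((lam * α) • (1 : Matrix (Fin p) (Fin p) ℝ)))
    (Matrix.fromBlocks
      (e.transpose * Ψ * e) (e.transpose * Ψ * X)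
      (X.transpose * Ψ * e)
      (X.transpose * Ψ * X + (lam * (1 - α)) • (1 : Matrix (Fin p) (Fin p) ℝ)))

/-- One full semismooth Newton step `Z ↦ Z - H(Z)⁻¹ F(Z)`. -/
def newtonStep (X : Matrix (Fin n) (Fin p) ℝ) (y : Fin n → ℝ) (γ lam α : ℝ) (Z : Vec p) :
    Vec p :=
  Z - WithLp.toLp 2
    (Matrix.mulVec (newtonDeriv X y γ lam α Z)⁻¹ (kktMap X y γ lam α Z).ofLp)

/-- (Q-)superlinear convergence: `z^k → z*` and `‖z^{k+1} - z*‖ = o(‖z^k - z*‖)`. -/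
def ConvergesSuperlinearly (z : ℕ → Vec p) (zstar : Vec p) : Prop :=
  Tendsto z atTop (𝓝 zstar) ∧
    (fun k => z (k + 1) - zstar) =o[atTop] (fun k => z k - zstar)

end HuberSNA

end

namespace HuberSNA

/-! The map `F` is continuous and piecewise affine, and `H(Z)` is the slope of a closed piece
containing `Z`. Near `Zhat` that piece also contains `Zhat`, so `F(Z) - F(Zhat) = H(Z)(Z - Zhat)`
with no remainder (`eventually_kktMap_sub`). Once `H(Z)` is invertible, a single Newton step lands
on `Zhat`: superlinear convergence is in fact termination after one step. Invertibility
(`isUnit_newtonDeriv`) is an energy argument: a kernel vector tested against its own `(β₀, β)` part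
gives a vanishing sum of nonnegative terms. -/

/-! ### Action of the Newton derivative on vectors. -/

open Matrix in
lemma newtonDeriv_mulVec_inl {n p : ℕ} (X : Matrix (Fin n) (Fin p) ℝ) (y : Fin n → ℝ)
    (γ lam α : ℝ) (Z : Vec p) (v : Idx p → ℝ) (j : Fin p) :
    (newtonDeriv X y γ lam α Z *ᵥ v) (Sum.inl j) =
      if 1 < |betaPart Z j + sPart Z j| then -v (Sum.inl j) else v (Sum.inr (Sum.inr j)) := by
  simp only [newtonDeriv, activeSet, mulVec, dotProduct, Fintype.sum_sum_type]
  simp [Matrix.diagonal_apply, ite_mul]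
  split_ifs with h <;> simp

open Matrix in
lemma psiMatrix_mul_apply {n p : ℕ} {κ : Type*} (X : Matrix (Fin n) (Fin p) ℝ) (y : Fin n → ℝ)
    (γ : ℝ) (Z : Vec p) {μ : Type*} (U : Matrix (Fin n) μ ℝ) (W : Matrix (Fin n) κ ℝ)
    (a : μ) (b : κ) :
    (Uᵀ * psiMatrix X y γ Z * W) a b =
      (1 / (n : ℝ)) * ∑ i, U i a * psi γ (residual X y Z i) * W i b := by
  rw [psiMatrix, Matrix.mul_smul, Matrix.smul_mul, Matrix.smul_apply, smul_eq_mul,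
    Matrix.mul_apply]
  simp [Matrix.mul_diagonal]

/-- The increment of the linear predictor in the direction `v = (s, β₀, β)`. -/
def predictor {n p : ℕ} (X : Matrix (Fin n) (Fin p) ℝ) (v : Idx p → ℝ) (i : Fin n) : ℝ :=
  v (Sum.inr (Sum.inl ())) + ∑ j, X i j * v (Sum.inr (Sum.inr j))

/-- Merges the `β₀` and `β` columns, so that the rows of `H` involve `v` through its linear
predictor. -/
lemma sum_weighted_predictor {n p : ℕ} (X : Matrix (Fin n) (Fin p) ℝ) (v : Idx p → ℝ)
    (c : ℝ) (w : Fin n → ℝ) :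
    c * (∑ i, w i) * v (Sum.inr (Sum.inl ())) +
        ∑ j, c * (∑ i, w i * X i j) * v (Sum.inr (Sum.inr j)) =
      c * ∑ i, w i * predictor X v i := by
  simp only [predictor, mul_add, Finset.sum_add_distrib, Finset.mul_sum, Finset.sum_mul]
  rw [Finset.sum_comm]
  congr 1
  · exact Finset.sum_congr rfl fun i _ => by ring
  · exact Finset.sum_congr rfl fun i _ => Finset.sum_congr rfl fun j _ => by ring

open Matrix in
lemma newtonDeriv_mulVec_intercept {n p : ℕ} (X : Matrix (Fin n) (Fin p) ℝ) (y : Fin n → ℝ)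
    (γ lam α : ℝ) (Z : Vec p) (v : Idx p → ℝ) :
    (newtonDeriv X y γ lam α Z *ᵥ v) (Sum.inr (Sum.inl ())) =
      (1 / (n : ℝ)) * ∑ i, psi γ (residual X y Z i) * predictor X v i := by
  rw [← sum_weighted_predictor]
  simp only [newtonDeriv, mulVec, dotProduct, Fintype.sum_sum_type, fromBlocks_apply₂₁,
    fromBlocks_apply₂₂, fromBlocks_apply₁₁, fromBlocks_apply₁₂, psiMatrix_mul_apply,
    fromRows_apply_inl]
  simp [onesCol]

open Matrix in
lemma newtonDeriv_mulVec_beta {n p : ℕ} (X : Matrix (Fin n) (Fin p) ℝ) (y : Fin n → ℝ)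
    (γ lam α : ℝ) (Z : Vec p) (v : Idx p → ℝ) (j : Fin p) :
    (newtonDeriv X y γ lam α Z *ᵥ v) (Sum.inr (Sum.inr j)) =
      (1 / (n : ℝ)) * ∑ i, X i j * psi γ (residual X y Z i) * predictor X v i
        + lam * α * v (Sum.inl j) + lam * (1 - α) * v (Sum.inr (Sum.inr j)) := by
  rw [← sum_weighted_predictor]
  simp only [newtonDeriv, mulVec, dotProduct, Fintype.sum_sum_type, fromBlocks_apply₂₁,
    fromBlocks_apply₂₂, psiMatrix_mul_apply, fromRows_apply_inr, Matrix.add_apply,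
    Matrix.smul_apply, Matrix.one_apply, add_mul, Finset.sum_add_distrib]
  simp [onesCol]
  ring

/-! ### Invertibility of the Newton derivative. -/

lemma psi_nonneg {γ : ℝ} (hγ : 0 < γ) (t : ℝ) : 0 ≤ psi γ t := by
  unfold psi; split_ifs <;> positivity

open Matrix in
/-- The Newton derivative is nonsingular as soon as one residual lies in the quadratic zone. -/
lemma isUnit_newtonDeriv {n p : ℕ} (X : Matrix (Fin n) (Fin p) ℝ) (y : Fin n → ℝ)
    {γ lam α : ℝ} (hγ : 0 < γ) (hlam : 0 < lam) (hα : α ∈ Set.Ioo (0 : ℝ) 1)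
    (Z : Vec p) (hZ : ∃ i, |residual X y Z i| ≤ γ) :
    IsUnit (newtonDeriv X y γ lam α Z) := by
  obtain ⟨i₀, hi₀⟩ := hZ
  -- The index `i₀` rules out `n = 0`, where `1 / n` would be `0`.
  have hn : (0 : ℝ) < 1 / n := by
    have : 0 < n := i₀.pos
    positivity
  rw [← Matrix.mulVec_injective_iff_isUnit]
  refine (injective_iff_map_eq_zero (newtonDeriv X y γ lam α Z).mulVecLin).2 fun v hv => ?_
  replace hv : newtonDeriv X y γ lam α Z *ᵥ v = 0 := hv
  -- The first block forces `s_j = 0` on `A` and `β_j = 0` on `B`; this removes the indefinite cross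
  -- term `λα s_j β_j` from the energy.
  have h₁ : ∀ j, v (Sum.inl j) * v (Sum.inr (Sum.inr j)) = 0 := fun j => by
    have := congrFun hv (Sum.inl j)
    rw [newtonDeriv_mulVec_inl] at this
    split_ifs at this <;> simp_all
  have h₂ := congrFun hv (Sum.inr (Sum.inl ()))
  have h₃ : ∀ j, _ := fun j => congrFun hv (Sum.inr (Sum.inr j))
  simp only [newtonDeriv_mulVec_intercept, newtonDeriv_mulVec_beta, Pi.zero_apply] at h₂ h₃
  have energy : (1 / (n : ℝ)) * ∑ i, psi γ (residual X y Z i) * predictor X v i ^ 2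
      + lam * (1 - α) * ∑ j, v (Sum.inr (Sum.inr j)) ^ 2 = 0 := by
    have expand : ∑ i, psi γ (residual X y Z i) * predictor X v i ^ 2 =
        v (Sum.inr (Sum.inl ())) * (∑ i, psi γ (residual X y Z i) * predictor X v i) +
        ∑ j, v (Sum.inr (Sum.inr j)) *
          ∑ i, X i j * psi γ (residual X y Z i) * predictor X v i := by
      simp only [Finset.mul_sum]
      rw [Finset.sum_comm, ← Finset.sum_add_distrib]
      refine Finset.sum_congr rfl fun i _ => ?_
      calc _ = psi γ (residual X y Z i) * predictor X v i * predictor X v i := by ring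
        _ = psi γ (residual X y Z i) * predictor X v i *
            (v (Sum.inr (Sum.inl ())) + ∑ j, X i j * v (Sum.inr (Sum.inr j))) := rfl
        _ = _ := by
          rw [mul_add, Finset.mul_sum]
          congr 1
          · ring
          · exact Finset.sum_congr rfl fun j _ => by ring
    have hsum : ∑ j, v (Sum.inr (Sum.inr j)) *
        ((1 / (n : ℝ)) * ∑ i, X i j * psi γ (residual X y Z i) * predictor X v i
        + lam * α * v (Sum.inl j) + lam * (1 - α) * v (Sum.inr (Sum.inr j))) = 0 :=
      Finset.sum_eq_zero fun j _ => by rw [h₃ j, mul_zero]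
    calc _ = v (Sum.inr (Sum.inl ())) *
          ((1 / (n : ℝ)) * ∑ i, psi γ (residual X y Z i) * predictor X v i) +
          ∑ j, v (Sum.inr (Sum.inr j)) *
        ((1 / (n : ℝ)) * ∑ i, X i j * psi γ (residual X y Z i) * predictor X v i
        + lam * α * v (Sum.inl j) + lam * (1 - α) * v (Sum.inr (Sum.inr j))) := by
          rw [expand, mul_add, Finset.mul_sum Finset.univ (fun j => _ * _) (1 / (n : ℝ)),
            Finset.mul_sum Finset.univ (fun j => _ ^ 2), add_assoc, ← Finset.sum_add_distrib]
          congr 1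
          · ring
          · exact Finset.sum_congr rfl fun j _ => by linear_combination (-(lam * α)) * h₁ j
      _ = 0 := by rw [h₂, hsum]; ring
  have hlam' : 0 < lam * (1 - α) := mul_pos hlam (sub_pos.2 hα.2)
  have nonneg_q : ∀ i ∈ Finset.univ,
      0 ≤ psi γ (residual X y Z i) * predictor X v i ^ 2 := fun i _ =>
    mul_nonneg (psi_nonneg hγ _) (sq_nonneg _)
  have nonneg_b : ∀ j ∈ Finset.univ, 0 ≤ v (Sum.inr (Sum.inr j)) ^ 2 := fun j _ => sq_nonneg _
  obtain ⟨hq, hb⟩ := (add_eq_zero_iff_of_nonneg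
    (mul_nonneg hn.le (Finset.sum_nonneg nonneg_q))
    (mul_nonneg hlam'.le (Finset.sum_nonneg nonneg_b))).1 energy
  have beta_zero : ∀ j, v (Sum.inr (Sum.inr j)) = 0 := fun j =>
    pow_eq_zero_iff two_ne_zero |>.1 <| (Finset.sum_eq_zero_iff_of_nonneg nonneg_b).1
      ((mul_eq_zero.1 hb).resolve_left hlam'.ne') j (Finset.mem_univ j)
  have pred : ∀ i, predictor X v i = v (Sum.inr (Sum.inl ())) := fun i => by
    simp [predictor, beta_zero]
  -- With `β = 0` every predictor equals `β₀`, and the weight at `i₀` is `1 / γ`, not `0`.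
  have intercept_zero : v (Sum.inr (Sum.inl ())) = 0 := by
    have := (Finset.sum_eq_zero_iff_of_nonneg nonneg_q).1
      ((mul_eq_zero.1 hq).resolve_left hn.ne') i₀ (Finset.mem_univ _)
    rw [pred, psi, if_pos hi₀] at this
    simpa [hγ.ne'] using this
  have s_zero : ∀ j, v (Sum.inl j) = 0 := fun j => by
    have := h₃ j
    simpa [pred, intercept_zero, beta_zero, hlam.ne', hα.1.ne'] using this
  funext k
  rcases k with j | ⟨⟨⟩⟩ | j
  · exact s_zero j
  · exact intercept_zero
  · exact beta_zero j

/-! ### Exact linearization on affine pieces. -/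

lemma softThreshold_of_abs_le {z : ℝ} (h : |z| ≤ 1) : softThreshold z = 0 := by
  rw [softThreshold, max_eq_right (by linarith), mul_zero]

lemma softThreshold_of_one_le {z : ℝ} (h : 1 ≤ z) : softThreshold z = z - 1 := by
  rw [softThreshold, Real.sign_of_pos (by linarith), abs_of_pos (by linarith),
    max_eq_left (by linarith), one_mul]

lemma softThreshold_of_le_neg_one {z : ℝ} (h : z ≤ -1) : softThreshold z = z + 1 := by
  rw [softThreshold, Real.sign_of_neg (by linarith), abs_of_neg (by linarith),
    max_eq_left (by linarith)]
  ring

lemma huberDeriv_of_abs_le {γ t : ℝ} (h : |t| ≤ γ) : huberDeriv γ t = t / γ := if_pos h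

/-- The two formulas agree at the kink `t = γ`, so the piece may be taken closed. -/
lemma huberDeriv_of_le {γ t : ℝ} (hγ : 0 < γ) (h : γ ≤ t) : huberDeriv γ t = 1 := by
  rcases h.eq_or_lt with rfl | h
  · rw [huberDeriv_of_abs_le (abs_of_pos hγ).le, div_self hγ.ne']
  · rw [huberDeriv, if_neg (by rw [abs_of_pos (hγ.trans h)]; exact h.not_ge),
      Real.sign_of_pos (hγ.trans h)]

lemma huberDeriv_neg (γ t : ℝ) : huberDeriv γ (-t) = -huberDeriv γ t := by
  simp only [huberDeriv, abs_neg, neg_div, Real.sign_neg]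
  split_ifs <;> rfl

lemma huberDeriv_of_le_neg {γ t : ℝ} (hγ : 0 < γ) (h : t ≤ -γ) : huberDeriv γ t = -1 := by
  rw [← neg_neg t, huberDeriv_neg, huberDeriv_of_le hγ (by linarith)]

/-- Points close to `t₀` lie with it on a common affine piece of any function that
is affine on `(-∞, -c]`, `[-c, c]` and `[c, ∞)`; the moving point selects the piece. -/
lemma eventually_same_piece (c t₀ : ℝ) :
    ∀ᶠ t in 𝓝 t₀, (|t| ≤ c ∧ |t₀| ≤ c) ∨ (c < |t| ∧ c ≤ t ∧ c ≤ t₀) ∨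
      (c < |t| ∧ t ≤ -c ∧ t₀ ≤ -c) := by
  -- Strict inequalities at `t₀` persist nearby; by contraposition, the piece of `t` constrains `t₀`
  -- weakly.
  have h₁ : ∀ᶠ t in 𝓝 t₀, c < |t₀| → c < |t| := by
    by_cases h : c < |t₀|
    · filter_upwards [continuous_abs.continuousAt.eventually (lt_mem_nhds h)] with t ht _ using ht
    · exact Eventually.of_forall fun t h' => absurd h' h
  have h₂ : ∀ᶠ t in 𝓝 t₀, t₀ < c → t < c := by
    by_cases h : t₀ < c
    · filter_upwards [gt_mem_nhds h] with t ht _ using ht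
    · exact Eventually.of_forall fun t h' => absurd h' h
  have h₃ : ∀ᶠ t in 𝓝 t₀, -c < t₀ → -c < t := by
    by_cases h : -c < t₀
    · filter_upwards [lt_mem_nhds h] with t ht _ using ht
    · exact Eventually.of_forall fun t h' => absurd h' h
  filter_upwards [h₁, h₂, h₃] with t k₁ k₂ k₃
  by_cases ht : |t| ≤ c
  · exact Or.inl ⟨ht, not_lt.1 fun h => (k₁ h).not_ge ht⟩
  · have ht' := not_le.1 ht
    rcases lt_abs.1 ht' with h | h
    · exact Or.inr (Or.inl ⟨ht', h.le, not_lt.1 fun h' => (k₂ h').not_gt h⟩)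
    · have h : t < -c := by linarith
      exact Or.inr (Or.inr ⟨ht', h.le, not_lt.1 fun h' => (k₃ h').not_gt h⟩)

/-- The slope is read off at `z`, so the identity survives when `z₀` is a kink. -/
lemma eventually_softThreshold_sub (z₀ : ℝ) :
    ∀ᶠ z in 𝓝 z₀, softThreshold z - softThreshold z₀ = if 1 < |z| then z - z₀ else 0 := by
  filter_upwards [eventually_same_piece 1 z₀] with z hz
  rcases hz with ⟨h, h₀⟩ | ⟨h, h₁, h₀⟩ | ⟨h, h₁, h₀⟩
  · rw [if_neg h.not_gt, softThreshold_of_abs_le h, softThreshold_of_abs_le h₀, sub_zero]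
  · rw [if_pos h, softThreshold_of_one_le h₁, softThreshold_of_one_le h₀]; ring
  · rw [if_pos h, softThreshold_of_le_neg_one h₁, softThreshold_of_le_neg_one h₀]; ring

lemma eventually_huberDeriv_sub {γ : ℝ} (hγ : 0 < γ) (t₀ : ℝ) :
    ∀ᶠ t in 𝓝 t₀, huberDeriv γ t - huberDeriv γ t₀ = psi γ t * (t - t₀) := by
  filter_upwards [eventually_same_piece γ t₀] with t ht
  rcases ht with ⟨h, h₀⟩ | ⟨h, h₁, h₀⟩ | ⟨h, h₁, h₀⟩
  · rw [psi, if_pos h, huberDeriv_of_abs_le h, huberDeriv_of_abs_le h₀]; ring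
  · rw [psi, if_neg h.not_ge, huberDeriv_of_le hγ h₁, huberDeriv_of_le hγ h₀]; ring
  · rw [psi, if_neg h.not_ge, huberDeriv_of_le_neg hγ h₁, huberDeriv_of_le_neg hγ h₀]; ring

lemma continuous_residual {n p : ℕ} (X : Matrix (Fin n) (Fin p) ℝ) (y : Fin n → ℝ) (i : Fin n) :
    Continuous fun Z : Vec p => residual X y Z i := by
  unfold residual interceptPart betaPart
  fun_prop

lemma residual_sub_residual {n p : ℕ} (X : Matrix (Fin n) (Fin p) ℝ) (y : Fin n → ℝ)
    (Z W : Vec p) (i : Fin n) :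
    residual X y Z i - residual X y W i = -predictor X (Z - W).ofLp i := by
  simp only [residual, predictor, interceptPart, betaPart, PiLp.sub_apply, mul_sub,
    Finset.sum_sub_distrib]
  ring

open Matrix in
/-- The KKT map is piecewise affine: near `W` its increment is exactly the Newton derivative. -/
lemma eventually_kktMap_sub {n p : ℕ} (X : Matrix (Fin n) (Fin p) ℝ) (y : Fin n → ℝ)
    {γ : ℝ} (hγ : 0 < γ) (lam α : ℝ) (W : Vec p) :
    ∀ᶠ Z in 𝓝 W, (kktMap X y γ lam α Z - kktMap X y γ lam α W).ofLp =
      newtonDeriv X y γ lam α Z *ᵥ (Z - W).ofLp := by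
  have hsoft : ∀ᶠ Z in 𝓝 W, ∀ j, _ := eventually_all.2 fun j =>
    (show Continuous fun Z : Vec p => betaPart Z j + sPart Z j by
      unfold betaPart sPart; fun_prop).continuousAt.eventually
      (eventually_softThreshold_sub (betaPart W j + sPart W j))
  have hhuber : ∀ᶠ Z in 𝓝 W, ∀ i, _ := eventually_all.2 fun i =>
    (continuous_residual X y i).continuousAt.eventually
      (eventually_huberDeriv_sub hγ (residual X y W i))
  filter_upwards [hsoft, hhuber] with Z hS hH
  have hH' : ∀ i, huberDeriv γ (residual X y Z i) = huberDeriv γ (residual X y W i) -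
      psi γ (residual X y Z i) * predictor X (Z - W).ofLp i := fun i => by
    have := hH i
    rw [residual_sub_residual] at this
    linear_combination this
  funext k
  rcases k with j | ⟨⟨⟩⟩ | j
  · rw [newtonDeriv_mulVec_inl]
    have := hS j
    simp only [kktMap, PiLp.sub_apply]
    split_ifs at this ⊢ with h
    · simp only [betaPart, sPart] at this ⊢
      linear_combination -this
    · simp only [betaPart, sPart] at this ⊢
      linear_combination -this
  · rw [newtonDeriv_mulVec_intercept]
    simp only [kktMap, PiLp.sub_apply, hH', Finset.sum_sub_distrib]
    ring
  · rw [newtonDeriv_mulVec_beta]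
    simp only [kktMap, PiLp.sub_apply, hH', mul_sub, Finset.sum_sub_distrib, betaPart, sPart,
      ← mul_assoc]
    ring

/-- Where the KKT map agrees with its Newton linearization, one Newton step is exact. -/
lemma newtonStep_eq {n p : ℕ} (X : Matrix (Fin n) (Fin p) ℝ) (y : Fin n → ℝ)
    {γ lam α : ℝ} {Z W : Vec p} (hW : kktMap X y γ lam α W = 0)
    (hunit : IsUnit (newtonDeriv X y γ lam α Z))
    (hlin : (kktMap X y γ lam α Z - kktMap X y γ lam α W).ofLp =
      Matrix.mulVec (newtonDeriv X y γ lam α Z) (Z - W).ofLp) :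
    newtonStep X y γ lam α Z = W := by
  rw [hW, sub_zero] at hlin
  rw [newtonStep, hlin, Matrix.mulVec_mulVec,
    Matrix.nonsing_inv_mul _ ((Matrix.isUnit_iff_isUnit_det _).1 hunit), Matrix.one_mulVec,
    WithLp.toLp_ofLp, sub_sub_cancel]

end HuberSNA

theorem theoremA {n p : ℕ} (X : Matrix (Fin n) (Fin p) ℝ) (y : Fin n → ℝ)
    (γ lam α : ℝ) (hγ : 0 < γ) (hlam : 0 < lam) (hα : α ∈ Set.Ioo (0 : ℝ) 1)
    (Zhat : HuberSNA.Vec p) (hsol : HuberSNA.kktMap X y γ lam α Zhat = 0)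
    (N : Set (HuberSNA.Vec p)) (hN : N ∈ 𝓝 Zhat)
    (hres : ∀ Z ∈ N, ∃ i : Fin n, |HuberSNA.residual X y Z i| ≤ γ) :
    ∃ δ : ℝ, 0 < δ ∧ ∀ Z : ℕ → HuberSNA.Vec p, ‖Z 0 - Zhat‖ < δ →
      (∀ k, Z (k + 1) = HuberSNA.newtonStep X y γ lam α (Z k)) →
      (∀ k, IsUnit (HuberSNA.newtonDeriv X y γ lam α (Z k))) ∧
        HuberSNA.ConvergesSuperlinearly Z Zhat := by
  have hgood : ∀ᶠ Z in 𝓝 Zhat, IsUnit (HuberSNA.newtonDeriv X y γ lam α Z) ∧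
      HuberSNA.newtonStep X y γ lam α Z = Zhat := by
    filter_upwards [hN, HuberSNA.eventually_kktMap_sub X y hγ lam α Zhat] with Z hZ hlin
    have hunit := HuberSNA.isUnit_newtonDeriv X y hγ hlam hα Z (hres Z hZ)
    exact ⟨hunit, HuberSNA.newtonStep_eq X y hsol hunit hlin⟩
  obtain ⟨δ, hδ, hball⟩ := Metric.eventually_nhds_iff.1 hgood
  refine ⟨δ, hδ, fun Z hZ₀ hZ => ?_⟩
  have hstart := hball (show dist (Z 0) Zhat < δ by rwa [dist_eq_norm])
  have hZsucc : ∀ k, Z (k + 1) = Zhat := by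
    intro k
    induction k with
    | zero => rw [hZ, hstart.2]
    -- `Zhat` lies in its own neighborhood, hence is a fixed point of the step.
    | succ k ih => rw [hZ, ih, hgood.self_of_nhds.2]
  refine ⟨fun k => ?_, ?_, ?_⟩
  · cases k with
    | zero => exact hstart.1
    | succ k => rw [hZsucc]; exact hgood.self_of_nhds.1
  -- Only `Z 0` can differ from `Zhat`; the shift discards it.
  · rw [← tendsto_add_atTop_iff_nat 1]
    simp only [hZsucc, tendsto_const_nhds]
  · simp only [hZsucc, sub_self]
    exact Asymptotics.isLittleO_zero _ _
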